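/- Let $\mathbf h=(h_1,\dots,h_M)^{\rm T}$ ($M\ge 1$) be a channel vector with the circularly symmetric complex Gaussian distribution $\mathcal{CN}(\mathbf 0,\mathbf R_{\mathbf h})$, where $\mathbf R_{\mathbf h}$ is an arbitrary covariance matrix with $[\mathbf R_{\mathbf h}]_{1,1}\neq 0$. Let $P>0$ be the transmit power, $R_{\rm th}\ge 0$ the target rate and $\alpha_{\rm th}=(2^{R_{\rm th}}-1)/P$. In the basic antenna-domain interleaved training scheme the antennas are trained in index order: antenna $1$ is trained first, and, with $l$ the number of antennas trained so far, as long as $\sum_{n=1}^{l}|h_n|^2<\alpha_{\rm th}$ and $l<M$, antenna $l+1$ is trained. The training length is the number of trained antennas when the scheme stops, and $L_t$ is its expectation (which is finite). For $m\ge 1$ let $\tilde{\mathbf R}_m$ consist of the first $m$ rows of the positive semidefinite square root $\mathbf R_{\mathbf h}^{1/2}$, and let $\tilde{\mathbf R}_m^{\rm H}\tilde{\mathbf R}_m=\mathbf U_m\boldsymbol\Sigma_m\mathbf U_m^{\rm H}$ be a compact eigenvalue decomposition, where $\mathbf U_m$ is an $M\times r_m$ matrix with $\mathbf U_m^{\rm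 H}\mathbf U_m=\mathbf I$, $r_m$ is the rank of $\tilde{\mathbf R}_m^{\rm H}\tilde{\mathbf R}_m$ and $\boldsymbol\Sigma_m={\rm diag}\{\delta_{m,1},\dots,\delta_{m,r_m}\}$ has positive diagonal entries. Let $\bar\delta_{m,1},\dots,\bar\delta_{m,T_m}$ be the different values among $\delta_{m,1},\dots,\delta_{m,r_m}$, repeated $r_{m,1},\dots,r_{m,T_m}$ times, respectively, and let $\mathbf r_m=[r_{m,1},\dots,r_{m,T_m}]^{\rm T}$. Then $$L_t=1+\sum_{m=1}^{M-1}\prod_{t=1}^{T_m}\left(\frac1{\bar\delta_{m,t}}\right)^{r_{m,t}}\sum_{k=1}^{T_m}\sum_{s=1}^{r_{m,k}}(-1)^{r_{m,k}-s}\,\bar\delta_{m,k}^{\,r_{m,k}-s+1}\,\Psi_{m,k,s,\mathbf r_m}\left[1-e^{-\alpha_{\rm th}/\bar\delta_{m,k}}\sum_{u=0}^{r_{m,k}-s}\frac{(\alpha_{\rm th}/\bar\delta_{m,k})^u}{u!}\right],$$ where $$\Psi_{m,k,s,\mathbf r_m}=(-1)^{r_{m,k}-1}\sum_{\mathbf i\in\Omega_{m,k,s}}\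 \prod_{n\ne k}\binom{i_n+r_{m,n}-1}{i_n}\left(\frac1{\bar\delta_{m,n}}-\frac1{\bar\delta_{m,k}}\right)^{-(i_n+r_{m,n})}$$ and $$\Omega_{m,k,s}=\Big\{[i_1,\dots,i_{T_m}]\in\mathbb Z^{T_m}:\ \sum_{j=1}^{T_m}i_j=s-1,\ i_k=0,\ i_j\ge 0\text{ for all }j\Big\}.$$ -/

import Mathlib

open MeasureTheory ProbabilityTheory
open scoped ComplexConjugate MatrixOrder

noncomputable section

/-- `h ∼ CN(0, R)`: the random vector `h` with values in `ℂ^M` is jointly Gaussian (over the reals),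
has mean zero and covariance matrix `E[h hᴴ] = R`, and is circularly symmetric, that is, its
pseudo-covariance matrix `E[h hᵀ]` is zero. -/
structure IsCircularGaussian {Ω : Type*} [MeasurableSpace Ω] {M : ℕ}
    (μ : Measure Ω) (h : Ω → Fin M → ℂ) (R : Matrix (Fin M) (Fin M) ℂ) : Prop where
  gaussian : HasGaussianLaw h μ
  mean_zero : ∀ i, ∫ ω, h ω i ∂μ = 0
  covariance : ∀ i j, ∫ ω, h ω i * conj (h ω j) ∂μ = R i j
  pseudoCovariance : ∀ i j, ∫ ω, h ω i * h ω j ∂μ = 0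

/-- The normalized receive SNR threshold `α_th = (2 ^ R_th - 1) / P` for the transmit power `P` and
the target rate `Rth`. -/
def snrThreshold (P Rth : ℝ) : ℝ := ((2 : ℝ) ^ Rth - 1) / P

/-- The index set of the first `l` antennas; antenna number `n` has the index `n - 1` in `Fin M`. -/
def firstAntennas (M l : ℕ) : Finset (Fin M) := {n | (n : ℕ) < l}

/-- The squared Euclidean norm of the sub-vector of `h` formed by the first `l` antennas. -/
def trainedEnergy {M : ℕ} (h : Fin M → ℂ) (l : ℕ) : ℝ := ∑ n ∈ firstAntennas M l, ‖h n‖ ^ 2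

/-- The while loop of the basic antenna-domain interleaved training, entered after `l` training
steps: as long as there is an outage and an untrained antenna is left, the next antenna in index
order is trained. The value is the number of training steps made when the loop ends. -/
def trainingLoop {M : ℕ} (α : ℝ) (h : Fin M → ℂ) (l : ℕ) : ℕ :=
  open scoped Classical in
  if trainedEnergy h l < α ∧ l < M then trainingLoop α h (l + 1) else l
termination_by M - l

/-- The training length of the basic scheme for the channel vector `h`: the scheme starts by
training the first antenna. -/
def trainingLength {M : ℕ} (α : ℝ) (h : Fin M → ℂ) : ℕ := trainingLoop α h 1

/-- The average training length `L_t`. -/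
def averageTrainingLength {Ω : Type*} [MeasurableSpace Ω] {M : ℕ}
    (μ : Measure Ω) (α : ℝ) (h : Ω → Fin M → ℂ) : ℝ :=
  ∫ ω, (trainingLength α (h ω) : ℝ) ∂μ

/-- The first `m` rows of the positive semidefinite square root of `R`. -/
def sqrtRows {M : ℕ} (R : Matrix (Fin M) (Fin M) ℂ) (m : ℕ) :
    Matrix (firstAntennas M m) (Fin M) ℂ :=
  (CFC.sqrt R).submatrix Subtype.val id

/-- The Gram matrix of the first `m` rows of the positive semidefinite square root of `R`. -/
def trainedGram {M : ℕ} (R : Matrix (Fin M) (Fin M) ℂ) (m : ℕ) : Matrix (Fin M) (Fin M) ℂ :=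
  (sqrtRows R m).conjTranspose * sqrtRows R m

/-- A compact eigenvalue decomposition `A = U Σ Uᴴ`, with `U` semi-unitary and `Σ` diagonal with
positive diagonal entries. The size of `Σ` is then the rank of `A`. -/
structure CompactEVD {M : ℕ} (A : Matrix (Fin M) (Fin M) ℂ) where
  /-- the rank of `A` -/
  rank : ℕ
  /-- the matrix of eigenvectors -/
  U : Matrix (Fin M) (Fin rank) ℂ
  /-- the nonzero eigenvalues, repeated according to multiplicity -/
  eig : Fin rank → ℝ
  eig_pos : ∀ j, 0 < eig j
  semiunitary : U.conjTranspose * U = 1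
  decomposition : A = U * Matrix.diagonal (fun j => (eig j : ℂ)) * U.conjTranspose

/-- A list, without repetition, of the different values of a finite family, with the number of times
that each of them occurs. -/
structure DistinctValues {r : ℕ} (eig : Fin r → ℝ) where
  /-- the number of different values -/
  T : ℕ
  /-- the different values -/
  value : Fin T → ℝ
  /-- how often each value is repeated -/
  mult : Fin T → ℕ
  value_injective : Function.Injective value
  range_value : Set.range value = Set.range eig
  mult_eq : ∀ t, mult t = Nat.card {j : Fin r // eig j = value t}

open scoped ComplexOrder in
/-- The Gram matrices above have compact eigenvalue decompositions. -/
theorem nonempty_compactEVD {M : ℕ} (R : Matrix (Fin M) (Fin M) ℂ) (m : ℕ) :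
    Nonempty (CompactEVD (trainedGram R m)) := by
  have hA : (trainedGram R m).PosSemidef := Matrix.posSemidef_conjTranspose_mul_self _
  generalize trainedGram R m = A at hA
  let ev := hA.1.eigenvalues
  let V : Matrix (Fin M) (Fin M) ℂ := hA.1.eigenvectorUnitary
  have hV : V.conjTranspose * V = 1 := Unitary.coe_star_mul_self hA.1.eigenvectorUnitary
  have hdec : A = V * Matrix.diagonal (fun i => (ev i : ℂ)) * V.conjTranspose := by
    have := hA.1.spectral_theorem
    rw [Unitary.conjStarAlgAut_apply] at this
    exact this
  let e := (Fintype.equivFin {i // ev i ≠ 0}).symm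
  refine ⟨⟨_, V.submatrix id (fun j => (e j : Fin M)), fun j => ev (e j), fun j => ?_, ?_, ?_⟩⟩
  · exact lt_of_le_of_ne (hA.eigenvalues_nonneg _) (e j).2.symm
  · rw [Matrix.conjTranspose_submatrix,
      ← Matrix.submatrix_mul _ _ _ _ _ Function.bijective_id, hV]
    exact Matrix.submatrix_one _ (Subtype.val_injective.comp e.injective)
  · ext i j
    have h1 := congrFun (congrFun hdec i) j
    rw [Matrix.mul_apply] at h1 ⊢
    simp only [Matrix.mul_diagonal, Matrix.conjTranspose_apply, Matrix.submatrix_apply, id] at h1 ⊢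
    rw [h1, Equiv.sum_comp e (fun k => V i k * (ev k : ℂ) * star (V j k))]
    rw [← Finset.sum_subtype (Finset.univ.filter (fun k => ev k ≠ 0)) (by simp)
      (fun k => V i k * (ev k : ℂ) * star (V j k)), Finset.sum_filter_of_ne]
    intro k _ hk h0
    simp [h0] at hk

/-- The different values of a finite family can be listed. -/
theorem nonempty_distinctValues {r : ℕ} (eig : Fin r → ℝ) : Nonempty (DistinctValues eig) := by
  classical
  let S := Finset.univ.image eig
  refine ⟨⟨S.card, fun t => S.equivFin.symm t,
    fun t => Nat.card {j : Fin r // eig j = (S.equivFin.symm t : ℝ)}, ?_, ?_, fun _ => rfl⟩⟩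
  · intro a b hab
    exact S.equivFin.symm.injective (Subtype.ext hab)
  · ext x
    constructor
    · rintro ⟨t, rfl⟩
      obtain ⟨j, -, hj⟩ := Finset.mem_image.1 (S.equivFin.symm t).2
      exact ⟨j, hj⟩
    · rintro ⟨j, rfl⟩
      exact ⟨S.equivFin ⟨eig j, by simp [S]⟩, by simp⟩

/-- The set `Ω_{k,s}` of the vectors of nonnegative integers with sum `s - 1` and `k`-th entry `0`
(used for `s ≥ 1` only). -/
def indexSet {T : ℕ} (k : Fin T) (s : ℕ) : Finset (Fin T → ℕ) :=
  {i ∈ Finset.piAntidiag Finset.univ (s - 1) | i k = 0}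

/-- The coefficient `Ψ_{k,s,r}` for the values `δ` with the multiplicities `r`. -/
def Psi {T : ℕ} (δ : Fin T → ℝ) (r : Fin T → ℕ) (k : Fin T) (s : ℕ) : ℝ :=
  (-1) ^ (r k - 1) * ∑ i ∈ indexSet k s, ∏ n ∈ Finset.univ.erase k,
    ((i n + r n - 1).choose (i n) : ℝ) * (1 / δ n - 1 / δ k) ^ (-((i n + r n : ℕ) : ℤ))

/-- The closed form of the probability that there is still an outage, for the values `δ` with the
multiplicities `r` and the threshold `α`. -/
def outageTerm {T : ℕ} (δ : Fin T → ℝ) (r : Fin T → ℕ) (α : ℝ) : ℝ :=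
  (∏ t, (1 / δ t) ^ r t) * ∑ k, ∑ s ∈ Finset.Icc 1 (r k),
    (-1) ^ (r k - s) * δ k ^ (r k - s + 1) * Psi δ r k s *
      (1 - Real.exp (-(α / δ k)) *
        ∑ u ∈ Finset.range (r k - s + 1), (α / δ k) ^ u / (u.factorial : ℝ))

end

/-! The trained energy `E_m` is nondecreasing in `m`, so the training length is 1 plus the number of
`m` in `[1, M - 1]` with `E_m < α`. Hence `L_t` is 1 plus the sum of the outage probabilities `P(E_m
< α)`.

Let `B` be the first `m` rows of `R^{1/2}`. The first `m` entries of `h` have covariance `B Bᴴ`;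
whitening them gives `y ∼ CN(0, I)` with `E_m = ∑ δ_j |y_j|²` almost surely, so `E_m` has
characteristic function `∏ (1 - i t δ_j)⁻¹` (`IsCircularGaussian.charFun_map_trainedEnergy`).

After equal eigenvalues are grouped, partial fractions in `w = i t` with poles `1 / δ_k`
(`sum_partialFraction_eq_one`) turn this product into a real combination of characteristic functions
of Erlang laws. The sums in `Psi` are the Taylor coefficients of the remaining factors at a pole. By
uniqueness of characteristic functions the law of `E_m` is the same signed mixture
(`measureReal_eq_sum_of_charFun_eq_sum`), and the Erlang distribution functions at `α` are the
brackets of the formula. -/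

/-! ### Training length as a count of outages -/

theorem trainedEnergy_mono {M : ℕ} (h : Fin M → ℂ) : Monotone (trainedEnergy h) := by
  intro a b hab
  refine Finset.sum_le_sum_of_subset_of_nonneg (fun n hn => ?_) fun _ _ _ => by positivity
  simp only [firstAntennas, Finset.mem_filter, Finset.mem_univ, true_and] at hn ⊢
  exact hn.trans_le hab

-- When the loop stops before `M`, monotonicity makes all later indicators vanish, so counting all
-- outages counts exactly the steps made.
open scoped Classical in
theorem trainingLoop_eq {M : ℕ} (α : ℝ) (h : Fin M → ℂ) (l : ℕ) :
    trainingLoop α h l =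
      l + ∑ m ∈ Finset.Ico l M, if trainedEnergy h m < α then 1 else 0 := by
  induction hk : M - l generalizing l with
  | zero =>
    rw [trainingLoop, if_neg (by omega), Finset.Ico_eq_empty (by omega)]
    simp
  | succ k ih =>
    rw [trainingLoop]
    split_ifs with hl
    · rw [ih (l + 1) (by omega), Finset.sum_eq_sum_Ico_succ_bot hl.2, if_pos hl.1, add_assoc]
    · rw [Finset.sum_eq_zero, add_zero]
      intro m hm
      have hα : ¬ trainedEnergy h l < α := fun h' => hl ⟨h', by omega⟩
      exact if_neg fun h' => hα ((trainedEnergy_mono h (Finset.mem_Ico.1 hm).1).trans_lt h')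

theorem trainingLength_eq {M : ℕ} (α : ℝ) (h : Fin M → ℂ) :
    (trainingLength α h : ℝ) =
      1 + ∑ m ∈ Finset.Icc 1 (M - 1), (Set.Iio α).indicator 1 (trainedEnergy h m) := by
  classical
  have hI : Finset.Ico 1 M = Finset.Icc 1 (M - 1) := by ext; simp; omega
  rw [trainingLength, trainingLoop_eq, hI]
  simp [Set.indicator_apply]

theorem measurable_trainedEnergy {M : ℕ} (l : ℕ) :
    Measurable fun h : Fin M → ℂ => trainedEnergy h l := by
  unfold trainedEnergy
  fun_prop

theorem integrable_trainingLength {Ω : Type*} [MeasurableSpace Ω] (μ : Measure Ω)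
    [IsProbabilityMeasure μ] {M : ℕ} (α : ℝ) {h : Ω → Fin M → ℂ} (hh : AEMeasurable h μ) :
    Integrable (fun ω => (trainingLength α (h ω) : ℝ)) μ ∧
    averageTrainingLength μ α h = 1 + ∑ m ∈ Finset.Icc 1 (M - 1),
      (μ.map fun ω => trainedEnergy (h ω) m).real (Set.Iio α) := by
  have hE (m : ℕ) : AEMeasurable (fun ω => trainedEnergy (h ω) m) μ :=
    (measurable_trainedEnergy m).comp_aemeasurable hh
  have hmap (m : ℕ) : IsProbabilityMeasure (μ.map fun ω => trainedEnergy (h ω) m) :=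
    Measure.isProbabilityMeasure_map (hE m)
  have hi (m : ℕ) : Integrable (fun ω => (Set.Iio α).indicator (1 : ℝ → ℝ)
      (trainedEnergy (h ω) m)) μ := by
    refine Integrable.comp_aemeasurable (g := (Set.Iio α).indicator (1 : ℝ → ℝ)) ?_ (hE m)
    exact (integrable_const (1 : ℝ)).indicator measurableSet_Iio
  unfold averageTrainingLength
  simp_rw [trainingLength_eq]
  refine ⟨(integrable_const _).add (integrable_finsetSum _ fun m _ => hi m), ?_⟩
  rw [integral_add (integrable_const _) (integrable_finsetSum _ fun m _ => hi m),
    integral_finsetSum _ fun m _ => hi m]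
  simp only [integral_const, probReal_univ, smul_eq_mul, mul_one]
  congr 1
  refine Finset.sum_congr rfl fun m _ => ?_
  rw [← integral_indicator_one measurableSet_Iio, integral_map (hE m)]
  exact (stronglyMeasurable_const.indicator measurableSet_Iio).aestronglyMeasurable

/-! ### Partial fractions with repeated poles -/

section PartialFractions
open Polynomial

/-- The power series of `(d - X) ^ (-r)`. -/
noncomputable def invSubPowSeries {K : Type*} [Field K] (d : K) (r : ℕ) : PowerSeries K :=
  PowerSeries.mk fun i => ((i + r - 1).choose i : K) * (d ^ (i + r))⁻¹

/-- Rescaling `X` by `d⁻¹` in the binomial series of `(1 - X) ^ (-r)` gives this series up to the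
factor `d ^ r`. -/
theorem invSubPowSeries_mul {K : Type*} [Field K] {d : K} (hd : d ≠ 0) {r : ℕ} (hr : 0 < r) :
    invSubPowSeries d r * ((C d - X : K[X]) ^ r : K[X]) = 1 := by
  obtain ⟨e, rfl⟩ : ∃ e, r = e + 1 := ⟨r - 1, by omega⟩
  have h := PowerSeries.mk_add_choose_mul_one_sub_pow_eq_one (S := K) e
  have h2 := congrArg (PowerSeries.rescale d⁻¹) h
  have e1 : (PowerSeries.rescale d⁻¹) (PowerSeries.mk fun n ↦ ((e + n).choose e : K)) =
      PowerSeries.C (d ^ (e + 1)) * invSubPowSeries d (e + 1) := by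
    ext n
    simp only [PowerSeries.coeff_rescale, PowerSeries.coeff_mk, invSubPowSeries,
      PowerSeries.coeff_C_mul]
    rw [show n + (e + 1) - 1 = e + n by omega, Nat.choose_symm_add, pow_add d n, inv_pow]
    field_simp
  have e2 : PowerSeries.C d * (PowerSeries.rescale d⁻¹ (1 - PowerSeries.X : PowerSeries K)) =
      ((C d - X : K[X]) : PowerSeries K) := by
    rw [map_sub, map_one, PowerSeries.rescale_X]
    push_cast
    rw [mul_sub, mul_one, ← mul_assoc, ← map_mul, mul_inv_cancel₀ hd, map_one, one_mul]
  rw [map_mul, map_pow, map_one, e1] at h2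
  rw [Polynomial.coe_pow, ← e2, mul_pow, ← map_pow, mul_left_comm, ← mul_assoc]
  exact h2

theorem X_pow_dvd_trunc_mul_sub_one {K : Type*} [Field K] (F : PowerSeries K) (Q : K[X]) (r : ℕ)
    (h : F * Q = 1) : X ^ r ∣ PowerSeries.trunc r F * Q - 1 := by
  rw [X_pow_dvd_iff]
  intro d hd
  rw [coeff_sub, sub_eq_zero, ← coeff_coe, Polynomial.coe_mul, ← coeff_coe, Polynomial.coe_one, ← h]
  rw [PowerSeries.coeff_mul, PowerSeries.coeff_mul]
  refine Finset.sum_congr rfl fun x hx => ?_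
  have := Finset.HasAntidiagonal.mem_antidiagonal.1 hx
  rw [coeff_coe, PowerSeries.coeff_trunc, if_pos (by omega)]

/-- The coefficient of `X ^ j` in the power series of `∏ n ≠ k, (l n - l k - X) ^ (- r n)`. -/
noncomputable def partialFractionCoeff {K : Type*} [Field K] {T : ℕ} (l : Fin T → K)
    (r : Fin T → ℕ) (k : Fin T) (j : ℕ) : K :=
  (∏ n ∈ Finset.univ.erase k, invSubPowSeries (l n - l k) (r n)).coeff j

/-- The `k`-th summand is 1 modulo `(X - l k) ^ r k`, its first factor being a truncated Taylor
inverse of the second, and 0 modulo the other prime powers. By coprimality the sum minus 1 is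
divisible by a polynomial of degree `∑ r`, but its own degree is smaller, so it vanishes. -/
theorem sum_partialFraction_eq_one {K : Type*} [Field K] {T : ℕ} {l : Fin T → K}
    (hl : Function.Injective l) {r : Fin T → ℕ} (hr : ∀ n, 0 < r n) [NeZero T] :
    ∑ k, (∑ j ∈ Finset.range (r k), C (partialFractionCoeff l r k j) * (X - C (l k)) ^ j) *
      ∏ n ∈ Finset.univ.erase k, (C (l n) - X) ^ r n = 1 := by
  set f : Fin T → K[X] := fun k =>
    (∑ j ∈ Finset.range (r k), C (partialFractionCoeff l r k j) * (X - C (l k)) ^ j) *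
      ∏ n ∈ Finset.univ.erase k, (C (l n) - X) ^ r n with hf
  have key (k : Fin T) : (X - C (l k)) ^ r k ∣ f k - 1 := by
    have h1 : (∏ n ∈ Finset.univ.erase k, invSubPowSeries (l n - l k) (r n)) *
        ((∏ n ∈ Finset.univ.erase k, (C (l n - l k) - X) ^ r n : K[X]) : PowerSeries K) = 1 := by
      rw [← coeToPowerSeries.ringHom_apply, map_prod, ← Finset.prod_mul_distrib]
      refine Finset.prod_eq_one fun n hn => invSubPowSeries_mul ?_ (hr n)
      exact sub_ne_zero.2 fun h => (Finset.ne_of_mem_erase hn) (hl h)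
    have h2 := X_pow_dvd_trunc_mul_sub_one _ _ (r k) h1
    -- Substituting `X - l k` for `X` moves the expansion point from 0 to the pole.
    have h3 := map_dvd (compRingHom (X - C (l k))) h2
    simp only [coe_compRingHom, pow_comp, X_comp, sub_comp, one_comp, mul_comp, prod_comp,
      C_comp] at h3
    convert h3 using 3
    · rw [PowerSeries.trunc_apply, Nat.Ico_zero_eq_range, ← coe_compRingHom_apply, map_sum]
      refine Finset.sum_congr rfl fun j _ => ?_
      rw [coe_compRingHom_apply, monomial_comp]
      rfl
    · refine Finset.prod_congr rfl fun n _ => ?_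
      rw [map_sub, sub_sub_sub_cancel_right]
  have key2 (k : Fin T) : (X - C (l k)) ^ r k ∣ ∑ n, f n - 1 := by
    rw [← Finset.add_sum_erase _ _ (Finset.mem_univ k), add_sub_right_comm]
    refine dvd_add (key k) (Finset.dvd_sum fun n hn => ?_)
    have hkn : k ∈ Finset.univ.erase n :=
      Finset.mem_erase.2 ⟨(Finset.ne_of_mem_erase hn).symm, Finset.mem_univ _⟩
    refine Dvd.dvd.mul_left (dvd_trans ?_
      (Finset.dvd_prod_of_mem (fun n => (C (l n) - X) ^ r n) hkn)) _
    rw [← neg_sub X, neg_pow]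
    exact dvd_mul_left _ _
  have key3 : ∏ k, (X - C (l k)) ^ r k ∣ ∑ n, f n - 1 :=
    Finset.prod_dvd_of_coprime (fun i _ j _ hij =>
      ((pairwise_coprime_X_sub_C hl hij).pow)) fun k _ => key2 k
  have hmon : (∏ k, (X - C (l k)) ^ r k).Monic := monic_prod_of_monic _ _ fun k _ =>
    (monic_X_sub_C _).pow _
  have hdeg : (∏ k, (X - C (l k)) ^ r k).natDegree = ∑ k, r k := by
    rw [natDegree_prod_of_monic _ _ fun k _ => (monic_X_sub_C _).pow _]
    simp
  refine sub_eq_zero.1 (eq_zero_of_dvd_of_degree_lt key3 ?_)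
  have hpos (k : Fin T) : r k - 1 + ∑ n ∈ Finset.univ.erase k, r n = ∑ n, r n - 1 := by
    have := Finset.add_sum_erase Finset.univ r (Finset.mem_univ k)
    have := hr k
    omega
  have hlin (n : Fin T) : (C (l n) - X).natDegree ≤ 1 := by compute_degree
  have hf_deg (k : Fin T) : (f k).natDegree ≤ ∑ n, r n - 1 := by
    rw [← hpos k]
    refine natDegree_mul_le.trans (add_le_add ?_ ?_)
    · refine natDegree_sum_le_of_forall_le _ _ fun j hj => ?_
      refine (natDegree_C_mul_le _ _).trans (natDegree_pow_le.trans ?_)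
      rw [natDegree_X_sub_C]
      have := Finset.mem_range.1 hj
      omega
    · refine (natDegree_prod_le _ _).trans (Finset.sum_le_sum fun n _ => ?_)
      exact (natDegree_pow_le_of_le _ (hlin n)).trans (by simp)
  apply degree_lt_degree
  rw [hdeg]
  have h0 : 0 < ∑ n, r n := Finset.sum_pos (fun n _ => hr n) Finset.univ_nonempty
  have h1 : (∑ n, f n).natDegree ≤ ∑ n, r n - 1 :=
    natDegree_sum_le_of_forall_le _ _ fun k _ => hf_deg k
  have h2 := natDegree_sub_le_of_le h1
    ((natDegree_one (R := K)).trans_le (Nat.zero_le (∑ n, r n - 1)))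
  rw [max_self] at h2
  exact h2.trans_lt (by omega)

theorem sum_indexSet_eq_partialFractionCoeff {K : Type*} [Field K] {T : ℕ} (l : Fin T → K)
    (r : Fin T → ℕ) (k : Fin T) (s : ℕ) :
    ∑ i ∈ indexSet k s, ∏ n ∈ Finset.univ.erase k,
      ((i n + r n - 1).choose (i n) : K) * (l n - l k) ^ (-((i n + r n : ℕ) : ℤ)) =
      partialFractionCoeff l r k (s - 1) := by
  rw [partialFractionCoeff, PowerSeries.coeff_prod]
  refine Finset.sum_bij' (fun i _ => Finsupp.equivFunOnFinite.symm i) (fun i _ => i) ?_ ?_ ?_ ?_ ?_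
  · intro i hi
    simp only [indexSet, Finset.mem_filter, Finset.mem_piAntidiag] at hi
    rw [Finset.mem_finsuppAntidiag]
    refine ⟨?_, fun n hn => ?_⟩
    · rw [← hi.1.1, ← Finset.add_sum_erase _ _ (Finset.mem_univ k), hi.2, zero_add]
      rfl
    · refine Finset.mem_erase.2 ⟨?_, Finset.mem_univ _⟩
      rintro rfl
      exact (Finsupp.mem_support_iff.1 hn) hi.2
  · intro i hi
    rw [Finset.mem_finsuppAntidiag] at hi
    have hik : i k = 0 := by
      by_contra h
      simpa using hi.2 (Finsupp.mem_support_iff.2 h)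
    simp only [indexSet, Finset.mem_filter, Finset.mem_piAntidiag]
    refine ⟨⟨?_, fun _ _ => Finset.mem_univ _⟩, hik⟩
    rw [← hi.1, ← Finset.add_sum_erase _ _ (Finset.mem_univ k), hik, zero_add]
  · intro i _
    rfl
  · intro i _
    ext
    rfl
  · intro i _
    refine Finset.prod_congr rfl fun n _ => ?_
    rw [zpow_neg, zpow_natCast, invSubPowSeries, PowerSeries.coeff_mk]
    rfl

end PartialFractions

/-! ### Signed mixtures from characteristic functions -/

section Mixture

theorem charFun_sum_smul_measure {E : Type*} [MeasurableSpace E] [SeminormedAddCommGroup E]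
    [InnerProductSpace ℝ E] [BorelSpace E] [SecondCountableTopology E] {ι : Type*} (s : Finset ι) (c : ι → NNReal)
    (γ : ι → Measure E) [∀ i, IsFiniteMeasure (γ i)] (t : E) :
    charFun (∑ i ∈ s, c i • γ i) t = ∑ i ∈ s, (c i : ℂ) * charFun (γ i) t := by
  simp only [charFun_apply]
  rw [integral_finsetSum_measure]
  · refine Finset.sum_congr rfl fun i _ => ?_
    rw [integral_smul_nnreal_measure]
    rfl
  · intro i _
    refine (integrable_const (1 : ℝ)).mono' (by fun_prop) ?_
    simp [Complex.norm_exp_ofReal_mul_I]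

/-- The coefficients may be negative. Moving their negative parts to the side of `μ` leaves two
genuine finite measures with the same characteristic function. -/
theorem measureReal_eq_sum_of_charFun_eq_sum {E : Type*} [MeasurableSpace E] [NormedAddCommGroup E]
    [InnerProductSpace ℝ E] [BorelSpace E] [SecondCountableTopology E] [CompleteSpace E]
    {ι : Type*} (s : Finset ι) (c : ι → ℝ) (μ : Measure E) [IsFiniteMeasure μ] (γ : ι → Measure E)
    [∀ i, IsFiniteMeasure (γ i)]
    (h : ∀ t, charFun μ t = ∑ i ∈ s, (c i : ℂ) * charFun (γ i) t) (A : Set E) :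
    μ.real A = ∑ i ∈ s, c i * (γ i).real A := by
  have hc (i : ι) : ((c i).toNNReal : ℝ) - ((-c i).toNNReal : ℝ) = c i := by
    simp only [Real.coe_toNNReal', max_zero_sub_max_neg_zero_eq_self]
  have key : μ + ∑ i ∈ s, (-c i).toNNReal • γ i = ∑ i ∈ s, (c i).toNNReal • γ i := by
    refine Measure.ext_of_charFun (funext fun t => ?_)
    have hadd : charFun (μ + ∑ i ∈ s, (-c i).toNNReal • γ i) t =
        charFun μ t + charFun (∑ i ∈ s, (-c i).toNNReal • γ i) t := by
      simp only [charFun_apply]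
      rw [integral_add_measure] <;>
      · refine (integrable_const (1 : ℝ)).mono' (by fun_prop) ?_
        simp [Complex.norm_exp_ofReal_mul_I]
    rw [hadd, charFun_sum_smul_measure, charFun_sum_smul_measure, h t, ← Finset.sum_add_distrib]
    refine Finset.sum_congr rfl fun i _ => ?_
    rw [← add_mul]
    congr 1
    have := hc i
    norm_cast
    linarith
  have h2 := congrArg (fun ν : Measure E => ν.real A) key
  have hsum (c : ι → NNReal) : (∑ i ∈ s, c i • γ i).real A = ∑ i ∈ s, c i * (γ i).real A := by
    rw [measureReal_def, Measure.finsetSum_apply, ENNReal.toReal_sum fun i _ => measure_ne_top _ _]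
    exact Finset.sum_congr rfl fun i _ => measureReal_nnreal_smul_apply (c i)
  rw [measureReal_add_apply, hsum, hsum] at h2
  rw [eq_sub_of_add_eq h2, ← Finset.sum_sub_distrib]
  refine Finset.sum_congr rfl fun i _ => ?_
  rw [← sub_mul, hc]

end Mixture

/-! ### Erlang laws: characteristic and distribution functions -/

section Erlang
open Filter Topology

/-- Differentiating the truncated exponential drops its last term, so only that term survives in the
product rule. This is the antiderivative behind both Erlang integrals below. -/
theorem hasDerivAt_exp_neg_mul_sum (n : ℕ) (y : ℂ) :
    HasDerivAt (fun y : ℂ => Complex.exp (-y) * ∑ u ∈ Finset.range (n + 1), y ^ u / (u.factorial : ℂ))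
      (-(Complex.exp (-y) * (y ^ n / (n.factorial : ℂ)))) y := by
  have h1 : HasDerivAt (fun y : ℂ => Complex.exp (-y)) (-Complex.exp (-y)) y := by
    simpa using (hasDerivAt_neg y).cexp
  have h2 : HasDerivAt (fun y : ℂ => ∑ u ∈ Finset.range (n + 1), y ^ u / (u.factorial : ℂ))
      (∑ u ∈ Finset.range n, y ^ u / (u.factorial : ℂ)) y := by
    have h3 := HasDerivAt.fun_sum (u := Finset.range (n + 1)) (x := y) fun u _ =>
      (hasDerivAt_pow u y).div_const (u.factorial : ℂ)
    refine h3.congr_deriv ?_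
    rw [Finset.sum_range_succ', Nat.cast_zero, zero_mul, zero_div, add_zero]
    refine Finset.sum_congr rfl fun u _ => ?_
    rw [Nat.factorial_succ]
    push_cast
    have : (u : ℂ) + 1 ≠ 0 := by exact_mod_cast Nat.succ_ne_zero u
    field_simp
  refine (h1.mul h2).congr_deriv ?_
  rw [Finset.sum_range_succ]
  ring

theorem tendsto_exp_neg_mul_sum {b : ℂ} (hb : 0 < b.re) (n : ℕ) :
    Tendsto (fun x : ℝ => Complex.exp (-(b * x)) *
      ∑ u ∈ Finset.range n, (b * x) ^ u / (u.factorial : ℂ)) atTop (𝓝 0) := by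
  simp_rw [Finset.mul_sum]
  rw [show (0 : ℂ) = ∑ u ∈ Finset.range n, (0 : ℂ) by simp]
  refine tendsto_finsetSum _ fun u _ => ?_
  rw [tendsto_zero_iff_norm_tendsto_zero]
  have h1 := (tendsto_rpow_mul_exp_neg_mul_atTop_nhds_zero u b.re hb).const_mul
    (‖b‖ ^ u / (u.factorial : ℝ))
  rw [mul_zero] at h1
  refine h1.congr' ?_
  filter_upwards [eventually_ge_atTop 0] with x hx
  rw [norm_mul, Complex.norm_exp, norm_div, norm_pow, norm_mul, Complex.norm_real, Real.norm_of_nonneg hx]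
  simp
  ring

theorem integral_Ioi_erlang {b : ℂ} (hb : 0 < b.re) (n : ℕ) :
    ∫ x : ℝ in Set.Ioi 0, Complex.exp (-(b * x)) * ((x : ℂ) ^ n / (n.factorial : ℂ)) =
      (b ^ (n + 1))⁻¹ := by
  have hb0 : b ≠ 0 := by
    rintro rfl
    simp at hb
  have hd (x : ℝ) : HasDerivAt (fun x : ℝ => -(b ^ (n + 1))⁻¹ * (Complex.exp (-(b * x)) *
      ∑ u ∈ Finset.range (n + 1), (b * x) ^ u / (u.factorial : ℂ)))
      (Complex.exp (-(b * x)) * ((x : ℂ) ^ n / (n.factorial : ℂ))) x := by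
    have h1 := ((hasDerivAt_exp_neg_mul_sum n (b * x)).comp (x : ℂ)
      ((hasDerivAt_id (x : ℂ)).const_mul b)).comp_ofReal.const_mul (-(b ^ (n + 1))⁻¹)
    refine h1.congr_deriv ?_
    simp only [mul_one, mul_pow]
    field_simp
    ring
  have hint : IntegrableOn (fun x : ℝ =>
      Complex.exp (-(b * x)) * ((x : ℂ) ^ n / (n.factorial : ℂ))) (Set.Ioi 0) := by
    have h1 := (integrableOn_rpow_mul_exp_neg_mul_rpow (p := 1) (s := n) (b := b.re)
      (by linarith [n.cast_nonneg (α := ℝ)]) one_pos hb).div_const (n.factorial : ℝ)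
    refine Integrable.mono' h1 (Continuous.aestronglyMeasurable (by fun_prop)) ?_
    refine (ae_restrict_iff' measurableSet_Ioi).2 (ae_of_all _ fun x hx => ?_)
    rw [norm_mul, Complex.norm_exp, norm_div, norm_pow, Complex.norm_real,
      Real.norm_of_nonneg (le_of_lt hx)]
    simp
    apply le_of_eq
    ring
  have h2 := integral_Ioi_of_hasDerivAt_of_tendsto' (fun x _ => hd x) hint
    ((tendsto_exp_neg_mul_sum hb (n + 1)).const_mul _)
  rw [h2]
  simp [Finset.sum_range_succ']

theorem gammaPDFReal_natCast_succ (n : ℕ) (r : ℝ) {x : ℝ} (hx : 0 ≤ x) :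
    gammaPDFReal ((n + 1 : ℕ) : ℝ) r x =
      r ^ (n + 1) * (Real.exp (-(r * x)) * (x ^ n / (n.factorial : ℝ))) := by
  rw [gammaPDFReal, if_pos hx, Real.rpow_natCast]
  push_cast
  rw [Real.Gamma_nat_eq_factorial, add_sub_cancel_right, Real.rpow_natCast]
  ring

/-- Multiplying the density by `exp (i t x)` only changes the rate in the exponential to the complex
number `r - i t`. -/
theorem charFun_gammaMeasure_natCast_succ (n : ℕ) {r : ℝ} (hr : 0 < r) (t : ℝ) :
    charFun (gammaMeasure ((n + 1 : ℕ) : ℝ) r) t =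
      (r : ℂ) ^ (n + 1) * (((r : ℂ) - t * Complex.I) ^ (n + 1))⁻¹ := by
  rw [charFun_apply_real, gammaMeasure, integral_withDensity_eq_integral_toReal_smul
    (by unfold gammaPDF; fun_prop) (by simp [gammaPDF])]
  rw [← integral_Ioi_erlang (b := (r : ℂ) - t * Complex.I) (by simpa using hr) n,
    ← integral_const_mul, ← integral_indicator measurableSet_Ioi]
  refine integral_congr_ae ?_
  filter_upwards [Measure.ae_ne volume (0 : ℝ)] with x hx
  rw [gammaPDF, ENNReal.toReal_ofReal (gammaPDFReal_nonneg (by positivity) hr x)]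
  rcases lt_or_gt_of_ne hx with hx | hx
  · rw [Set.indicator_of_notMem (by simpa using hx.le), gammaPDFReal, if_neg (by linarith), zero_smul]
  · rw [Set.indicator_of_mem (by simpa using hx), gammaPDFReal_natCast_succ n r hx.le, Complex.real_smul]
    push_cast
    rw [show -(((r : ℂ) - t * Complex.I) * x) = -(r * x) + t * x * Complex.I by ring, Complex.exp_add]
    ring

theorem gammaMeasure_natCast_succ_real_Iio (n : ℕ) {r : ℝ} (hr : 0 < r) {α : ℝ} (hα : 0 ≤ α) :
    (gammaMeasure ((n + 1 : ℕ) : ℝ) r).real (Set.Iio α) =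
      1 - Real.exp (-(r * α)) * ∑ u ∈ Finset.range (n + 1), (r * α) ^ u / (u.factorial : ℝ) := by
  have hpos : (0 : ℝ) < ((n + 1 : ℕ) : ℝ) := by positivity
  have hprob := isProbabilityMeasure_gammaMeasure hpos hr
  have hna : gammaMeasure ((n + 1 : ℕ) : ℝ) r {α} = 0 :=
    (withDensity_absolutelyContinuous _ _) Real.volume_singleton
  rw [measureReal_congr (Iio_ae_eq_Iic' hna), ← cdf_eq_real, cdf_gammaMeasure_eq_integral hpos hr]
  have hd (x : ℝ) : HasDerivAt (fun x : ℝ => -(Real.exp (-(r * x)) *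
      ∑ u ∈ Finset.range (n + 1), (r * x) ^ u / (u.factorial : ℝ)))
      (r ^ (n + 1) * (Real.exp (-(r * x)) * (x ^ n / (n.factorial : ℝ)))) x := by
    have h1 := ((hasDerivAt_exp_neg_mul_sum n (r * x)).comp (x : ℂ)
      ((hasDerivAt_id (x : ℂ)).const_mul (r : ℂ))).neg.real_of_complex
    convert h1 using 1
    · ext y
      simp only [Pi.neg_apply, Function.comp_apply, Complex.neg_re, neg_inj]
      norm_cast
    · rw [mul_one, neg_mul, neg_neg]
      norm_cast
      ring
  have h0 : ∫ x in Set.Iic α, gammaPDFReal ((n + 1 : ℕ) : ℝ) r x =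
      ∫ x in Set.Ioc 0 α, r ^ (n + 1) * (Real.exp (-(r * x)) * (x ^ n / (n.factorial : ℝ))) := by
    rw [← integral_indicator measurableSet_Iic, ← integral_indicator measurableSet_Ioc]
    refine integral_congr_ae ?_
    filter_upwards [Measure.ae_ne volume (0 : ℝ)] with x hx
    rcases lt_or_gt_of_ne hx with hx | hx
    · have hx' : ¬ (0 < x) := hx.not_gt
      have hx2 : ¬ (0 ≤ x) := hx.not_ge
      simp only [Set.indicator_apply, gammaPDFReal, Set.mem_Ioc, hx', hx2, false_and, if_false,
        ite_self]
    · simp only [Set.indicator_apply, Set.mem_Iic, Set.mem_Ioc, hx, true_and]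
      rw [gammaPDFReal_natCast_succ n r hx.le]
  rw [h0, ← intervalIntegral.integral_of_le hα,
    intervalIntegral.integral_eq_sub_of_hasDerivAt (fun x _ => hd x)
      (Continuous.intervalIntegrable (by fun_prop) _ _)]
  simp [Finset.sum_range_succ']
  ring

end Erlang

/-! ### From the characteristic function to the closed form -/

theorem Psi_eq_partialFractionCoeff {T : ℕ} (δ : Fin T → ℝ) (r : Fin T → ℕ) (k : Fin T) (s : ℕ) :
    Psi δ r k s = (-1) ^ (r k - 1) * partialFractionCoeff (fun n => 1 / δ n) r k (s - 1) := by
  rw [Psi, ← sum_indexSet_eq_partialFractionCoeff]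

-- This is the polynomial identity evaluated at `w` and divided by the full product; the sign comes
-- from `(w - l k) ^ j = (-1) ^ j * (l k - w) ^ j` with `j = s - 1`.
open Polynomial in
theorem prod_inv_pow_eq_sum_partialFraction {T : ℕ} [NeZero T] {l : Fin T → ℝ}
    (hl : Function.Injective l) {r : Fin T → ℕ} (hr : ∀ n, 0 < r n) {w : ℂ}
    (hw : ∀ n, (l n : ℂ) - w ≠ 0) :
    ∏ n, (((l n : ℂ) - w) ^ r n)⁻¹ = ∑ k, ∑ s ∈ Finset.Icc 1 (r k),
      (((-1) ^ (s - 1) * partialFractionCoeff l r k (s - 1) : ℝ) : ℂ) *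
        (((l k : ℂ) - w) ^ (r k - s + 1))⁻¹ := by
  have h1 := congrArg (aeval w) (sum_partialFraction_eq_one hl hr)
  simp only [map_sum, map_mul, map_prod, map_pow, map_sub, aeval_X, aeval_C, map_one] at h1
  rw [← mul_one (∏ n, _), ← h1, Finset.mul_sum]
  refine Finset.sum_congr rfl fun k _ => ?_
  rw [← Finset.mul_prod_erase _ _ (Finset.mem_univ k), mul_mul_mul_comm,
    ← Finset.prod_mul_distrib, Finset.prod_eq_one (s := Finset.univ.erase k), mul_one,
    Finset.mul_sum]
  · refine Finset.sum_nbij' (· + 1) (· - 1) ?_ ?_ ?_ ?_ ?_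
    · simp only [Finset.mem_range, Finset.mem_Icc]
      omega
    · simp only [Finset.mem_range, Finset.mem_Icc]
      omega
    · simp
    · simp only [Finset.mem_Icc]
      omega
    · intro j hj
      have hj := Finset.mem_range.1 hj
      have hpow : ((l k : ℂ) - w) ^ r k = ((l k : ℂ) - w) ^ j * ((l k : ℂ) - w) ^ (r k - j) := by
        rw [← pow_add, Nat.add_sub_cancel' hj.le]
      rw [show r k - (j + 1) + 1 = r k - j by omega, hpow, Nat.add_sub_cancel,
        Complex.coe_algebraMap, ← neg_sub (l k : ℂ) w, neg_pow, mul_inv]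
      have := pow_ne_zero j (hw k)
      push_cast
      field_simp
  · intro n _
    exact inv_mul_cancel₀ (pow_ne_zero _ (hw n))

theorem measureReal_Iio_eq_outageTerm {T : ℕ} [NeZero T] {δ : Fin T → ℝ}
    (hδ : Function.Injective δ) (hpos : ∀ n, 0 < δ n) {r : Fin T → ℕ} (hr : ∀ n, 0 < r n)
    (ν : Measure ℝ) [IsFiniteMeasure ν]
    (hν : ∀ t : ℝ, charFun ν t = ∏ n, ((1 - t * δ n * Complex.I) ^ r n)⁻¹) {α : ℝ} (hα : 0 ≤ α) :
    ν.real (Set.Iio α) = outageTerm δ r α := by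
  set l : Fin T → ℝ := fun n => 1 / δ n with hl_def
  have hl_pos (n : Fin T) : 0 < l n := one_div_pos.2 (hpos n)
  have hl : Function.Injective l := fun a b h => hδ (by simpa [hl_def] using h)
  let γ : (Σ _ : Fin T, ℕ) → Measure ℝ := fun i =>
    gammaMeasure ((r i.1 - i.2 + 1 : ℕ) : ℝ) (l i.1)
  have hγ (i : Σ _ : Fin T, ℕ) : IsProbabilityMeasure (γ i) :=
    isProbabilityMeasure_gammaMeasure (by positivity) (hl_pos _)
  let c : (Σ _ : Fin T, ℕ) → ℝ := fun i => (∏ t, l t ^ r t) *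
    ((-1) ^ (r i.1 - i.2) * δ i.1 ^ (r i.1 - i.2 + 1) * Psi δ r i.1 i.2)
  rw [measureReal_eq_sum_of_charFun_eq_sum (Finset.univ.sigma fun k => Finset.Icc 1 (r k)) c ν γ,
    Finset.sum_sigma, outageTerm, Finset.mul_sum]
  · refine Finset.sum_congr rfl fun k _ => ?_
    rw [Finset.mul_sum]
    refine Finset.sum_congr rfl fun s _ => ?_
    simp only [γ, c]
    rw [gammaMeasure_natCast_succ_real_Iio _ (hl_pos k) hα, mul_assoc,
      show l k * α = α / δ k by simp only [hl_def]; ring]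
  · intro t
    have hw (n : Fin T) : (l n : ℂ) - t * Complex.I ≠ 0 := by
      intro h
      have := congrArg Complex.re h
      simp at this
      exact (hl_pos n).ne' this
    have hδ0 (n : Fin T) : (δ n : ℂ) ≠ 0 := by exact_mod_cast (hpos n).ne'
    have hlδ (n : Fin T) : (l n : ℂ) = (δ n : ℂ)⁻¹ := by simp [hl_def]
    -- Since `l = 1 / δ`, one has `(1 - i t δ)⁻¹ = l (l - i t)⁻¹`, which produces the leading
    -- product of `outageTerm`.
    have hν' : charFun ν t = (∏ n, (l n : ℂ) ^ r n) *
        ∏ n, (((l n : ℂ) - t * Complex.I) ^ r n)⁻¹ := by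
      rw [hν, ← Finset.prod_mul_distrib]
      refine Finset.prod_congr rfl fun n _ => ?_
      rw [← inv_pow, ← inv_pow, ← mul_pow, hlδ]
      congr 1
      rw [← inv_inv ((δ n : ℂ)⁻¹), ← mul_inv, inv_inv]
      congr 1
      have := hδ0 n
      field_simp
    rw [hν', prod_inv_pow_eq_sum_partialFraction hl hr hw, Finset.sum_sigma, Finset.mul_sum]
    refine Finset.sum_congr rfl fun k _ => ?_
    rw [Finset.mul_sum]
    refine Finset.sum_congr rfl fun s hs => ?_
    have hs := Finset.mem_Icc.1 hs
    simp only [γ, c]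
    rw [charFun_gammaMeasure_natCast_succ _ (hl_pos k), Psi_eq_partialFractionCoeff]
    -- The explicit sign and the one inside `Psi` together give the partial fraction sign.
    have hsign : ((-1 : ℂ)) ^ (r k - s) * (-1) ^ (r k - 1) = (-1) ^ (s - 1) := by
      rw [show r k - 1 = (r k - s) + (s - 1) by omega, pow_add, ← mul_assoc, ← mul_pow]
      simp
    have hδl : (δ k : ℂ) ^ (r k - s + 1) * (l k : ℂ) ^ (r k - s + 1) = 1 := by
      rw [← mul_pow, hlδ, mul_inv_cancel₀ (hδ0 k), one_pow]
    push_cast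
    rw [← hsign]
    linear_combination (-((∏ n, (l n : ℂ) ^ r n) * ((-1 : ℂ)) ^ (r k - s) * (-1) ^ (r k - 1) *
      ((partialFractionCoeff l r k (s - 1) : ℝ) : ℂ) * (((l k : ℂ) - t * Complex.I) ^ (r k - s + 1))⁻¹)) * hδl

/-! ### Circular Gaussian vectors and their quadratic forms -/

section CircularGaussian

/-- The real and imaginary parts of a standard entry contribute equal factors, so only the square is
needed, and it removes the complex square root. -/
theorem sq_integral_cexp_sq_gaussianReal (s : ℝ) :
    (∫ x, Complex.exp (s * (x : ℂ) ^ 2 * Complex.I) ∂(gaussianReal 0 (1 / 2))) ^ 2 =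
      (1 - s * Complex.I)⁻¹ := by
  have hb : 0 < (1 - s * Complex.I).re := by simp
  have hb0 : 1 - s * Complex.I ≠ 0 := by
    intro h
    simp [h] at hb
  have hπ : (Real.pi : ℂ) ≠ 0 := by exact_mod_cast Real.pi_ne_zero
  have hpdf (x : ℝ) : gaussianPDFReal 0 (1 / 2) x • Complex.exp (s * (x : ℂ) ^ 2 * Complex.I) =
      ((√Real.pi)⁻¹ : ℝ) * Complex.exp (-(1 - s * Complex.I) * (x : ℂ) ^ 2) := by
    rw [gaussianPDFReal, Complex.real_smul,
      show 2 * Real.pi * ((1 / 2 : NNReal) : ℝ) = Real.pi by push_cast; ring]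
    push_cast
    rw [mul_assoc, ← Complex.exp_add]
    congr 2
    ring
  rw [integral_gaussianReal_eq_integral_smul (by norm_num)]
  simp_rw [hpdf]
  rw [integral_const_mul, integral_gaussian_complex hb, mul_pow, ← Complex.cpow_nat_mul,
    ← Complex.ofReal_pow, inv_pow, Real.sq_sqrt Real.pi_pos.le]
  norm_num
  field_simp

variable {Ω : Type*} [MeasurableSpace Ω] {μ : Measure Ω} {M : ℕ} {h : Ω → Fin M → ℂ}
  {R : Matrix (Fin M) (Fin M) ℂ}

namespace IsCircularGaussian

theorem memLp_apply (hh : IsCircularGaussian μ h R) (i : Fin M) : MemLp (fun ω => h ω i) 2 μ :=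
  (hh.gaussian.map_fun (ContinuousLinearMap.proj (R := ℝ) (φ := fun _ : Fin M => ℂ) i)).memLp_two

theorem integrable_mul (hh : IsCircularGaussian μ h R) (i j : Fin M) :
    Integrable (fun ω => h ω i * h ω j) μ :=
  (hh.memLp_apply i).integrable_mul (hh.memLp_apply j)

theorem integrable_mul_conj (hh : IsCircularGaussian μ h R) (i j : Fin M) :
    Integrable (fun ω => h ω i * conj (h ω j)) μ :=
  (hh.memLp_apply i).integrable_mul (hh.memLp_apply j).star

theorem integral_mulVec_mul_conj (hh : IsCircularGaussian μ h R) {ι : Type*}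
    (A : Matrix ι (Fin M) ℂ) (i j : ι) :
    ∫ ω, A.mulVec (h ω) i * conj (A.mulVec (h ω) j) ∂μ = (A * R * A.conjTranspose) i j := by
  have h1 (ω : Ω) : A.mulVec (h ω) i * conj (A.mulVec (h ω) j) =
      ∑ l, ∑ k, A i k * conj (A j l) * (h ω k * conj (h ω l)) := by
    simp only [Matrix.mulVec, dotProduct, map_sum, map_mul, Finset.sum_mul_sum]
    rw [Finset.sum_comm]
    exact Finset.sum_congr rfl fun _ _ => Finset.sum_congr rfl fun _ _ => by ring
  simp_rw [h1]
  rw [integral_finsetSum _ fun l _ => integrable_finsetSum _ fun k _ =>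
    (hh.integrable_mul_conj k l).const_mul _, Matrix.mul_apply]
  refine Finset.sum_congr rfl fun l _ => ?_
  rw [integral_finsetSum _ fun k _ => (hh.integrable_mul_conj k l).const_mul _, Matrix.mul_apply,
    Finset.sum_mul]
  refine Finset.sum_congr rfl fun k _ => ?_
  rw [integral_const_mul, hh.covariance, Matrix.conjTranspose_apply]
  simp only [RCLike.star_def]
  ring

theorem integral_mulVec_mul (hh : IsCircularGaussian μ h R) {ι : Type*}
    (A : Matrix ι (Fin M) ℂ) (i j : ι) :
    ∫ ω, A.mulVec (h ω) i * A.mulVec (h ω) j ∂μ = 0 := by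
  have h1 (ω : Ω) : A.mulVec (h ω) i * A.mulVec (h ω) j =
      ∑ l, ∑ k, A i k * A j l * (h ω k * h ω l) := by
    simp only [Matrix.mulVec, dotProduct, Finset.sum_mul_sum]
    rw [Finset.sum_comm]
    exact Finset.sum_congr rfl fun _ _ => Finset.sum_congr rfl fun _ _ => by ring
  simp_rw [h1]
  rw [integral_finsetSum _ fun l _ => integrable_finsetSum _ fun k _ =>
    (hh.integrable_mul k l).const_mul _]
  refine Finset.sum_eq_zero fun l _ => ?_
  rw [integral_finsetSum _ fun k _ => (hh.integrable_mul k l).const_mul _]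
  refine Finset.sum_eq_zero fun k _ => ?_
  rw [integral_const_mul, hh.pseudoCovariance, mul_zero]

theorem mulVec (hh : IsCircularGaussian μ h R) {k : ℕ} (A : Matrix (Fin k) (Fin M) ℂ) :
    IsCircularGaussian μ (fun ω => A.mulVec (h ω)) (A * R * A.conjTranspose) where
  gaussian := hh.gaussian.map_fun (LinearMap.toContinuousLinearMap (A.mulVecLin.restrictScalars ℝ))
  mean_zero i := by
    simp only [Matrix.mulVec, dotProduct]
    have := hh.gaussian.isProbabilityMeasure
    rw [integral_finsetSum _ fun k _ => ((hh.memLp_apply k).integrable one_le_two).const_mul _]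
    refine Finset.sum_eq_zero fun k _ => ?_
    rw [integral_const_mul, hh.mean_zero, mul_zero]
  covariance := hh.integral_mulVec_mul_conj A
  pseudoCovariance := hh.integral_mulVec_mul A

/-- The diagonal entries of `A R Aᴴ` are the second moments of the entries of `A h`. -/
theorem ae_mulVec_eq_zero (hh : IsCircularGaussian μ h R) {ι : Type*} [Finite ι]
    {A : Matrix ι (Fin M) ℂ} (hA : A * R * A.conjTranspose = 0) :
    ∀ᵐ ω ∂μ, A.mulVec (h ω) = 0 := by
  have h1 (i : ι) : ∀ᵐ ω ∂μ, A.mulVec (h ω) i = 0 := by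
    have h2 := hh.integral_mulVec_mul_conj A i i
    rw [hA, Matrix.zero_apply] at h2
    simp_rw [Complex.mul_conj, Complex.normSq_eq_norm_sq] at h2
    rw [integral_complex_ofReal, Complex.ofReal_eq_zero] at h2
    have hprob := hh.gaussian.isProbabilityMeasure
    have hL : MemLp (fun ω => A.mulVec (h ω) i) 2 μ := by
      simp only [Matrix.mulVec, dotProduct]
      exact memLp_finsetSum _ fun k _ => (hh.memLp_apply k).const_mul _
    rw [integral_eq_zero_iff_of_nonneg (fun ω => by positivity) hL.integrable_norm_pow'] at h2
    filter_upwards [h2] with ω hω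
    simpa using hω
  filter_upwards [ae_all_iff.2 h1] with ω hω
  exact funext hω

open scoped ComplexOrder in
theorem posSemidef (hh : IsCircularGaussian μ h R) : R.PosSemidef := by
  refine Matrix.PosSemidef.of_dotProduct_mulVec_nonneg ?_ fun x => ?_
  · ext i j
    rw [Matrix.conjTranspose_apply, ← hh.covariance, ← hh.covariance]
    simp only [RCLike.star_def]
    rw [← integral_conj]
    simp [mul_comm]
  · have h1 := hh.integral_mulVec_mul_conj (Matrix.of fun (_ : Unit) => star x) () ()
    have h2 : star x ⬝ᵥ R.mulVec x = ((Matrix.of fun (_ : Unit) => star x) * R *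
        (Matrix.of fun (_ : Unit) => star x).conjTranspose) () () := by
      rw [Matrix.mul_assoc, Matrix.mul_apply]
      simp [Matrix.mul_apply, dotProduct, Matrix.mulVec]
    rw [h2, ← h1]
    simp_rw [Complex.mul_conj]
    rw [integral_complex_ofReal, Complex.zero_le_real]
    exact integral_nonneg fun ω => Complex.normSq_nonneg _

end IsCircularGaussian

/-- The real part (index `true`) or the imaginary part (index `false`) of a complex number. -/
noncomputable def realCoord : Bool → ℂ →L[ℝ] ℝ
  | true => Complex.reCLM
  | false => Complex.imCLM

/-- The sum and difference of `z * conj w` and `z * w` are `2 z Re w` and `-2i z Im w`; their real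
and imaginary parts isolate the four real correlations. -/
theorem IsCircularGaussian.integral_realCoord_mul {y : Ω → Fin M → ℂ}
    (hy : IsCircularGaussian μ y 1) (p q : Fin M × Bool) :
    ∫ ω, realCoord p.2 (y ω p.1) * realCoord q.2 (y ω q.1) ∂μ = if p = q then 1 / 2 else 0 := by
  obtain ⟨i, a⟩ := p
  obtain ⟨j, b⟩ := q
  have hc := hy.integrable_mul_conj i j
  have hm := hy.integrable_mul i j
  have h1 : ∫ ω, (y ω i * conj (y ω j) + y ω i * y ω j) ∂μ = (1 : Matrix (Fin M) (Fin M) ℂ) i j := by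
    rw [integral_add hc hm, hy.covariance, hy.pseudoCovariance, add_zero]
  have h2 : ∫ ω, (y ω i * conj (y ω j) - y ω i * y ω j) ∂μ = (1 : Matrix (Fin M) (Fin M) ℂ) i j := by
    rw [integral_sub hc hm, hy.covariance, hy.pseudoCovariance, sub_zero]
  have hre {f : Ω → ℂ} (hf : Integrable f μ) : ∫ ω, (f ω).re ∂μ = (∫ ω, f ω ∂μ).re :=
    integral_re hf
  have him {f : Ω → ℂ} (hf : Integrable f μ) : ∫ ω, (f ω).im ∂μ = (∫ ω, f ω ∂μ).im :=
    integral_im hf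
  have h1r := (hre (hc.add hm)).trans (congrArg Complex.re h1)
  have h1i := (him (hc.add hm)).trans (congrArg Complex.im h1)
  have h2r := (hre (hc.sub hm)).trans (congrArg Complex.re h2)
  have h2i := (him (hc.sub hm)).trans (congrArg Complex.im h2)
  simp only [Pi.add_apply, Pi.sub_apply, Complex.add_re, Complex.sub_re,
    Complex.add_im, Complex.sub_im, Complex.mul_re, Complex.mul_im, Complex.conj_re,
    Complex.conj_im] at h1r h1i h2r h2i
  have hone : ((1 : Matrix (Fin M) (Fin M) ℂ) i j).re = if i = j then 1 else 0 := by
    rw [Matrix.one_apply]; split_ifs <;> simp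
  have hone' : ((1 : Matrix (Fin M) (Fin M) ℂ) i j).im = 0 := by
    rw [Matrix.one_apply]; split_ifs <;> simp
  rw [hone] at h1r h2r
  rw [hone'] at h1i h2i
  have half {f : Ω → ℝ} {g : Ω → ℝ} {c : ℝ} (hf : ∫ ω, f ω ∂μ = c) (d : ℝ)
      (hfg : ∀ ω, g ω = d * f ω) : ∫ ω, g ω ∂μ = d * c := by
    simp_rw [hfg]
    rw [integral_const_mul, hf]
  cases a <;> cases b <;> simp only [realCoord, Complex.reCLM_apply, Complex.imCLM_apply,
    Prod.mk.injEq, and_true, and_false, if_false, reduceCtorEq]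
  · rw [half h2r (1 / 2) fun ω => by ring]
    simp
  · rw [half h1i (1 / 2) fun ω => by ring]
    simp
  · rw [half h2i (-1 / 2) fun ω => by ring]
    simp
  · rw [half h1r (1 / 2) fun ω => by ring]
    simp

/-- The `2 M` real coordinates are jointly Gaussian and uncorrelated, hence independent with law
`N(0, 1/2)`, and the exponential factors over them. -/
theorem IsCircularGaussian.charFun_map_sum_mul_norm_sq {y : Ω → Fin M → ℂ}
    (hy : IsCircularGaussian μ y 1) (δ : Fin M → ℝ) (t : ℝ) :
    charFun (μ.map fun ω => ∑ j, δ j * ‖y ω j‖ ^ 2) t =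
      ∏ j, (1 - t * δ j * Complex.I)⁻¹ := by
  have hprob := hy.gaussian.isProbabilityMeasure
  let X : Fin M × Bool → Ω → ℝ := fun p ω => realCoord p.2 (y ω p.1)
  have hX : HasGaussianLaw (fun ω p => X p ω) μ :=
    hy.gaussian.map_fun (ContinuousLinearMap.pi fun p : Fin M × Bool =>
      (realCoord p.2).comp (ContinuousLinearMap.proj (R := ℝ) (φ := fun _ : Fin M => ℂ) p.1))
  have hXp (p : Fin M × Bool) : HasGaussianLaw (X p) μ :=
    hX.map_fun (ContinuousLinearMap.proj (R := ℝ) (φ := fun _ : Fin M × Bool => ℝ) p)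
  have hmean (p : Fin M × Bool) : ∫ ω, X p ω ∂μ = 0 := by
    simp only [X]
    rw [ContinuousLinearMap.integral_comp_comm _ ((hy.memLp_apply _).integrable one_le_two),
      hy.mean_zero, map_zero]
  have hcov (p q : Fin M × Bool) : cov[X p, X q; μ] = if p = q then 1 / 2 else 0 := by
    rw [covariance_eq_sub (hXp p).memLp_two (hXp q).memLp_two, hmean, zero_mul, sub_zero]
    exact hy.integral_realCoord_mul p q
  have hind : iIndepFun X μ := hX.iIndepFun_of_covariance_eq_zero fun p q hpq => by
    rw [hcov, if_neg hpq]
  have hlaw (p : Fin M × Bool) : μ.map (X p) = gaussianReal 0 (1 / 2) := by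
    rw [(hXp p).map_eq_gaussianReal, hmean, ← covariance_self (hXp p).aemeasurable, hcov, if_pos rfl]
    congr 1
    ext
    simp
  have hym : AEMeasurable y μ := hy.gaussian.aemeasurable
  have hmeas : Measurable fun z : Fin M → ℂ => ∑ j, δ j * ‖z j‖ ^ 2 := by fun_prop
  have hsum : AEMeasurable (fun ω => ∑ j, δ j * ‖y ω j‖ ^ 2) μ := hmeas.comp_aemeasurable hym
  rw [charFun_apply_real, integral_map hsum (by fun_prop)]
  have hexp (ω : Ω) : Complex.exp (t * (∑ j, δ j * ‖y ω j‖ ^ 2 : ℝ) * Complex.I) =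
      ∏ p : Fin M × Bool, Complex.exp ((t * δ p.1 : ℝ) * (X p ω : ℂ) ^ 2 * Complex.I) := by
    rw [← Complex.exp_sum, Fintype.sum_prod_type]
    congr 1
    push_cast
    rw [Finset.mul_sum, Finset.sum_mul]
    refine Finset.sum_congr rfl fun j _ => ?_
    rw [Fintype.sum_bool, ← Complex.ofReal_pow, Complex.sq_norm, Complex.normSq_apply]
    simp only [X, realCoord, Complex.reCLM_apply, Complex.imCLM_apply]
    push_cast
    ring
  simp_rw [hexp]
  rw [hind.integral_fun_prod_comp
    (f := fun p (x : ℝ) => Complex.exp ((t * δ p.1 : ℝ) * (x : ℂ) ^ 2 * Complex.I))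
    (fun p => (hXp p).aemeasurable) fun p => by fun_prop, Fintype.prod_prod_type]
  refine Finset.prod_congr rfl fun j _ => ?_
  have hint (p : Fin M × Bool) :
      ∫ ω, Complex.exp ((t * δ p.1 : ℝ) * (X p ω : ℂ) ^ 2 * Complex.I) ∂μ =
      ∫ x, Complex.exp ((t * δ p.1 : ℝ) * (x : ℂ) ^ 2 * Complex.I) ∂(gaussianReal 0 (1 / 2)) := by
    rw [← hlaw p, integral_map (hXp p).aemeasurable (by fun_prop)]
  rw [Fintype.prod_bool]
  refine (congrArg₂ (· * ·) (hint (j, true)) (hint (j, false))).trans ?_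
  refine (sq _).symm.trans ((sq_integral_cexp_sq_gaussianReal (t * δ j)).trans ?_)
  push_cast
  rfl

end CircularGaussian

/-! ### Algebra of the compact eigenvalue decomposition -/

section CompactEVD
open Matrix

namespace CompactEVD

variable {M : ℕ} {A : Matrix (Fin M) (Fin M) ℂ} (D : CompactEVD A)

/-- The inverse of the diagonal factor. -/
noncomputable def invEig : Matrix (Fin D.rank) (Fin D.rank) ℂ := diagonal fun j => ((D.eig j)⁻¹ : ℂ)

theorem invEig_mul : D.invEig * diagonal (fun j => (D.eig j : ℂ)) = 1 := by
  rw [invEig, diagonal_mul_diagonal, ← diagonal_one]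
  congr 1
  ext j
  exact inv_mul_cancel₀ (by exact_mod_cast (D.eig_pos j).ne')

theorem conjTranspose_mul :
    D.U.conjTranspose * A = diagonal (fun j => (D.eig j : ℂ)) * D.U.conjTranspose := by
  refine (congrArg (D.U.conjTranspose * ·) D.decomposition).trans ?_
  rw [← Matrix.mul_assoc, ← Matrix.mul_assoc, D.semiunitary, Matrix.one_mul]

theorem conjTranspose_mul_mul : D.U.conjTranspose * A * D.U = diagonal fun j => (D.eig j : ℂ) := by
  rw [D.conjTranspose_mul, Matrix.mul_assoc, D.semiunitary, Matrix.mul_one]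

theorem mul_mul_conjTranspose : A * (D.U * D.U.conjTranspose) = A := by
  refine (congrArg (· * (D.U * D.U.conjTranspose)) D.decomposition).trans
    (Eq.trans ?_ D.decomposition.symm)
  rw [Matrix.mul_assoc, ← Matrix.mul_assoc D.U.conjTranspose, D.semiunitary, Matrix.one_mul]

end CompactEVD

end CompactEVD

/-! ### Whitening of a possibly singular covariance -/

section Whitening
open Matrix

variable {M : ℕ} {ι : Type*} [Fintype ι] {B : Matrix ι (Fin M) ℂ} (D : CompactEVD (Bᴴ * B))

-- The defect `N = B U Uᴴ - B` satisfies `Bᴴ N = 0`, hence `Nᴴ N = 0`.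
open scoped ComplexOrder in
theorem mul_conjTranspose_eq_self_of_gram : B * (D.U * D.Uᴴ) = B := by
  rw [← sub_eq_zero, ← conjTranspose_mul_self_eq_zero]
  have h1 : Bᴴ * (B * (D.U * D.Uᴴ) - B) = 0 := by
    rw [Matrix.mul_sub, ← Matrix.mul_assoc, D.mul_mul_conjTranspose, sub_self]
  rw [conjTranspose_sub, Matrix.sub_mul, h1, sub_zero, conjTranspose_mul, Matrix.mul_assoc, h1,
    Matrix.mul_zero]

/-- The matrix that maps a vector with covariance matrix `B * Bᴴ` to its whitened coordinates. -/
noncomputable def whitening : Matrix (Fin D.rank) ι ℂ := D.invEig * D.Uᴴ * Bᴴ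

theorem whitening_mul : whitening D * B = D.Uᴴ := by
  rw [whitening, Matrix.mul_assoc, Matrix.mul_assoc, D.conjTranspose_mul, ← Matrix.mul_assoc, D.invEig_mul,
    Matrix.one_mul]

/-- On the range of `B`, whitening is undone by `B U`, even if `B Bᴴ` is singular. -/
theorem mul_mul_whitening_mul : B * D.U * whitening D * B = B := by
  rw [Matrix.mul_assoc, whitening_mul, Matrix.mul_assoc, mul_conjTranspose_eq_self_of_gram]

theorem sum_norm_sq_mulVec (y : Fin D.rank → ℂ) :
    ∑ i, ‖((B * D.U).mulVec y) i‖ ^ 2 = ∑ j, D.eig j * ‖y j‖ ^ 2 := by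
  have h1 {κ : Type _} [Fintype κ] (x : κ → ℂ) : ((∑ i, ‖x i‖ ^ 2 : ℝ) : ℂ) = star x ⬝ᵥ x := by
    simp only [dotProduct, Pi.star_apply, RCLike.star_def, Complex.conj_mul']
    push_cast
    rfl
  have h2 : ((∑ i, ‖((B * D.U).mulVec y) i‖ ^ 2 : ℝ) : ℂ) =
      ((∑ j, D.eig j * ‖y j‖ ^ 2 : ℝ) : ℂ) := by
    rw [h1, star_mulVec, ← dotProduct_mulVec, mulVec_mulVec, conjTranspose_mul, Matrix.mul_assoc,
      ← Matrix.mul_assoc Bᴴ, ← Matrix.mul_assoc, D.conjTranspose_mul_mul]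
    simp only [dotProduct, mulVec_diagonal, Pi.star_apply, RCLike.star_def]
    push_cast
    refine Finset.sum_congr rfl fun j _ => ?_
    rw [← Complex.conj_mul']
    ring
  exact_mod_cast h2

end Whitening

/-! ### Law of the trained energy -/

section TrainedEnergy
open Matrix

/-- The matrix that selects the first `m` coordinates. -/
def selectFirst (M m : ℕ) : Matrix (firstAntennas M m) (Fin M) ℂ :=
  (1 : Matrix (Fin M) (Fin M) ℂ).submatrix Subtype.val id

theorem selectFirst_mulVec {M m : ℕ} (x : Fin M → ℂ) (i : firstAntennas M m) :
    (selectFirst M m).mulVec x i = x i := by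
  simp [selectFirst, Matrix.mulVec, dotProduct, Matrix.one_apply]

theorem selectFirst_mul_sqrt {M : ℕ} (R : Matrix (Fin M) (Fin M) ℂ) (m : ℕ) :
    selectFirst M m * CFC.sqrt R = sqrtRows R m := by
  ext i j
  simp [selectFirst, sqrtRows, Matrix.mul_apply, Matrix.one_apply]

theorem trainedEnergy_eq_sum_selectFirst {M : ℕ} (x : Fin M → ℂ) (m : ℕ) :
    trainedEnergy x m = ∑ i, ‖(selectFirst M m).mulVec x i‖ ^ 2 := by
  simp_rw [selectFirst_mulVec]
  exact (Finset.sum_coe_sort (firstAntennas M m) fun n => ‖x n‖ ^ 2).symm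

variable {Ω : Type*} [MeasurableSpace Ω] {μ : Measure Ω} {M : ℕ} {h : Ω → Fin M → ℂ}
  {R : Matrix (Fin M) (Fin M) ℂ}

theorem IsCircularGaussian.sqrt_mul_sqrt (hh : IsCircularGaussian μ h R) :
    CFC.sqrt R * CFC.sqrt R = R :=
  CFC.sqrt_mul_sqrt_self R (Matrix.nonneg_iff_posSemidef.2 hh.posSemidef)

theorem conjTranspose_sqrt (R : Matrix (Fin M) (Fin M) ℂ) : (CFC.sqrt R)ᴴ = CFC.sqrt R :=
  (Matrix.nonneg_iff_posSemidef.1 (CFC.sqrt_nonneg R)).1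

theorem IsCircularGaussian.mul_mul_conjTranspose (hh : IsCircularGaussian μ h R) {κ : Type*}
    (A : Matrix κ (Fin M) ℂ) : A * R * Aᴴ = A * CFC.sqrt R * (A * CFC.sqrt R)ᴴ := by
  conv_lhs => rw [← hh.sqrt_mul_sqrt]
  rw [conjTranspose_mul, conjTranspose_sqrt]
  simp only [Matrix.mul_assoc]

theorem IsCircularGaussian.charFun_map_trainedEnergy (hh : IsCircularGaussian μ h R) (m : ℕ)
    (D : CompactEVD (trainedGram R m)) (t : ℝ) :
    charFun (μ.map fun ω => trainedEnergy (h ω) m) t = ∏ j, (1 - t * D.eig j * Complex.I)⁻¹ := by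
  set B := sqrtRows R m
  let E := selectFirst M m
  let W : Matrix (Fin D.rank) (firstAntennas M m) ℂ := whitening (B := B) D
  have hES : E * CFC.sqrt R = B := selectFirst_mul_sqrt R m
  have hy : IsCircularGaussian μ (fun ω => (W * E).mulVec (h ω)) 1 := by
    have h1 := hh.mulVec (W * E)
    rwa [hh.mul_mul_conjTranspose, Matrix.mul_assoc W, hES, whitening_mul (B := B) D,
      conjTranspose_conjTranspose, D.semiunitary] at h1
  -- The reconstruction error of the first `m` entries has zero covariance, so it vanishes almost
  -- surely.
  have hQ : (E - B * D.U * W * E) * R * (E - B * D.U * W * E)ᴴ = 0 := by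
    rw [hh.mul_mul_conjTranspose, Matrix.sub_mul, Matrix.mul_assoc _ E, hES,
      mul_mul_whitening_mul (B := B) D, sub_self, Matrix.zero_mul]
  rw [← hy.charFun_map_sum_mul_norm_sq]
  congr 1
  refine Measure.map_congr ?_
  filter_upwards [hh.ae_mulVec_eq_zero hQ] with ω hω
  rw [Matrix.sub_mulVec, sub_eq_zero] at hω
  rw [trainedEnergy_eq_sum_selectFirst, ← sum_norm_sq_mulVec (B := B) D, mulVec_mulVec,
    ← Matrix.mul_assoc]
  simp_rw [← hω]
  rfl

-- Rank 0 would make the first row of `R^{1/2}` zero, and with it `R 0 0`. Positive rank keeps the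
-- partial fraction expansion from being empty.
open scoped ComplexOrder in
theorem IsCircularGaussian.rank_pos [NeZero M] (hh : IsCircularGaussian μ h R) (hR : R 0 0 ≠ 0)
    {m : ℕ} (hm : 1 ≤ m) (D : CompactEVD (trainedGram R m)) : 0 < D.rank := by
  by_contra h0
  have hempty : IsEmpty (Fin D.rank) := by
    rw [Nat.eq_zero_of_not_pos h0]
    infer_instance
  have h1 : trainedGram R m = 0 := by
    rw [D.decomposition]
    ext i j
    rw [Matrix.mul_apply, Finset.univ_eq_empty, Finset.sum_empty, Matrix.zero_apply]
  rw [trainedGram, conjTranspose_mul_self_eq_zero] at h1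
  have h2 (k : Fin M) : CFC.sqrt R 0 k = 0 :=
    congrFun (congrFun h1 ⟨0, by simp [firstAntennas]; omega⟩) k
  apply hR
  rw [← hh.sqrt_mul_sqrt, Matrix.mul_apply]
  exact Finset.sum_eq_zero fun k _ => by rw [h2, zero_mul]

end TrainedEnergy

/-! ### Grouping equal eigenvalues -/

namespace DistinctValues

variable {r : ℕ} {eig : Fin r → ℝ} (G : DistinctValues eig)

theorem mult_pos (t : Fin G.T) : 0 < G.mult t := by
  obtain ⟨j, hj⟩ : G.value t ∈ Set.range eig := G.range_value ▸ Set.mem_range_self t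
  rw [G.mult_eq]
  have : Nonempty {j : Fin r // eig j = G.value t} := ⟨⟨j, hj⟩⟩
  exact Nat.card_pos

theorem value_pos (h : ∀ j, 0 < eig j) (t : Fin G.T) : 0 < G.value t := by
  obtain ⟨j, hj⟩ : G.value t ∈ Set.range eig := G.range_value ▸ Set.mem_range_self t
  exact hj ▸ h j

theorem T_pos (hr : 0 < r) : 0 < G.T := by
  obtain ⟨t, -⟩ : eig ⟨0, hr⟩ ∈ Set.range G.value := G.range_value ▸ Set.mem_range_self _
  exact t.pos

theorem prod_comp_eq_prod_pow {K : Type*} [CommMonoid K] (f : ℝ → K) :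
    ∏ j, f (eig j) = ∏ t, f (G.value t) ^ G.mult t := by
  classical
  have hex (j : Fin r) : ∃ t, G.value t = eig j := by
    have : eig j ∈ Set.range G.value := G.range_value ▸ Set.mem_range_self j
    exact this
  choose g hg using hex
  have hiff (j : Fin r) (t : Fin G.T) : g j = t ↔ eig j = G.value t := by
    rw [← hg j, G.value_injective.eq_iff]
  rw [← Finset.prod_fiberwise Finset.univ g]
  refine Finset.prod_congr rfl fun t _ => ?_
  rw [G.mult_eq, Nat.card_eq_fintype_card, Fintype.card_subtype]
  simp_rw [hiff]
  refine Finset.prod_eq_pow_card fun j hj => ?_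
  rw [(Finset.mem_filter.1 hj).2]

end DistinctValues

/-! ### Average training length -/

theorem snrThreshold_nonneg {P Rth : ℝ} (hP : 0 < P) (hRth : 0 ≤ Rth) : 0 ≤ snrThreshold P Rth :=
  div_nonneg (sub_nonneg.2 (Real.one_le_rpow one_le_two hRth)) hP.le

theorem theorem2 {Ω : Type*} [MeasurableSpace Ω] (μ : Measure Ω) [IsProbabilityMeasure μ]
    (M : ℕ) [NeZero M] (P Rth : ℝ) (hP : 0 < P) (hRth : 0 ≤ Rth)
    (R : Matrix (Fin M) (Fin M) ℂ) (hR : R 0 0 ≠ 0)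
    (h : Ω → Fin M → ℂ) (hh : IsCircularGaussian μ h R)
    (D : ∀ m : ℕ, CompactEVD (trainedGram R m))
    (G : ∀ m : ℕ, DistinctValues (D m).eig) :
    Integrable (fun ω => (trainingLength (snrThreshold P Rth) (h ω) : ℝ)) μ ∧
    averageTrainingLength μ (snrThreshold P Rth) h =
      1 + ∑ m ∈ Finset.Icc 1 (M - 1),
        outageTerm (G m).value (G m).mult (snrThreshold P Rth) := by
  obtain ⟨hint, havg⟩ := integrable_trainingLength μ (snrThreshold P Rth) hh.gaussian.aemeasurable
  refine ⟨hint, havg.trans ?_⟩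
  congr 1
  refine Finset.sum_congr rfl fun m hm => ?_
  have : NeZero (G m).T :=
    ⟨((G m).T_pos (hh.rank_pos hR (Finset.mem_Icc.1 hm).1 (D m))).ne'⟩
  refine measureReal_Iio_eq_outageTerm (G m).value_injective ((G m).value_pos (D m).eig_pos)
    (G m).mult_pos _ (fun t => ?_) (snrThreshold_nonneg hP hRth)
  rw [hh.charFun_map_trainedEnergy m (D m),
    (G m).prod_comp_eq_prod_pow fun x => (1 - t * x * Complex.I)⁻¹]
  simp_rw [inv_pow]
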